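/- Let $n\ge 1$, $\kappa\in(0,2]$, and let $B_{1},\dots,B_{n}$ be mutually independent standard fractional Brownian motions on $\mathbb R$ with common Hurst index $\kappa/2$, i.e. independent centered Gaussian processes with almost surely continuous sample paths and covariance $\mathrm{Cov}(B_i(s),B_i(t))=\tfrac12\big(|s|^{\kappa}+|t|^{\kappa}-|s-t|^{\kappa}\big)$. Let $C=(C_1,\dots,C_n)\in\mathbb R^n$ with $C_i\ge 0$ for all $i$ and $C\ne 0$. For $S>0$ put $$\mathcal H_{CB_\kappa}(S)=\int_{\mathbb R^n} e^{\sum_{i=1}^n w_i}\,\mathbb P\Big(\exists\, t\in[0,S]\ \forall\, i\in\{1,\dots,n\}:\ \sqrt2\,C_iB_i(t)-\mathrm{Var}(C_iB_i(t))>w_i\Big)\,dw .$$ Then the multidimensional Pickands constant $$\mathcal H_{CB_\kappa}:=\lim_{S\to\infty}\frac{\mathcal H_{CB_\kappa}(S)}{S}$$ exists, is finite, and satisfies $$\mathcal H_{CB_\kappa}\ \ge\ \frac{\left(\sum_{i=1}^n C_i^2\right)^{1/\kappa}}{4^{1+1/\kappa}\,\Gamma(1/\kappa+1)} .$$ In particular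 $\mathcal H_{CB_\kappa}>0$. -/

import Mathlib

open MeasureTheory ProbabilityTheory Filter Topology
open scoped ENNReal

/-- A real-valued process `X`, indexed by `ℝ`, is a standard fractional Brownian motion with Hurst
index `h` under `P`: a centered Gaussian process with covariance
`(|s|^(2h) + |t|^(2h) - |s - t|^(2h)) / 2` and almost surely continuous sample paths. -/
structure IsFractionalBrownianMotion {Ω : Type*} [MeasurableSpace Ω] (h : ℝ)
    (X : ℝ → Ω → ℝ) (P : Measure Ω) : Prop where
  isGaussianProcess : IsGaussianProcess X P
  integral_eq_zero : ∀ t, ∫ ω, X t ω ∂P = 0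
  covariance_eq : ∀ s t,
    cov[X s, X t; P] = (|s| ^ (2 * h) + |t| ^ (2 * h) - |s - t| ^ (2 * h)) / 2
  continuous_paths : ∀ᵐ ω ∂P, Continuous fun t ↦ X t ω

/-- `B = (B₁, …, Bₙ)` is an `n`-dimensional vector of mutually independent standard fractional
Brownian motions on `ℝ` with common Hurst index `h`. -/
structure IsVectorFractionalBrownianMotion {Ω : Type*} [MeasurableSpace Ω] {n : ℕ} (h : ℝ)
    (B : Fin n → ℝ → Ω → ℝ) (P : Measure Ω) : Prop where
  isFractionalBrownianMotion : ∀ i, IsFractionalBrownianMotion h (B i) P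
  independent : iIndepFun (fun i ω t ↦ B i t ω) P

/-- The quantity `H_{Y,d}[a,b]`, that is the integral over `w ∈ ℝⁿ` of `exp (w₁ + ⋯ + wₙ)` times
the probability that, at some common time `t ∈ [a,b]`,
`√2 Yᵢ(t) - Var Yᵢ(t) - dᵢ(t) > wᵢ` for all `i`. It takes values in `[0,∞]`. -/
noncomputable def pickandsPiterbargIntegral {Ω : Type*} [MeasurableSpace Ω] {n : ℕ}
    (P : Measure Ω) (Y : Fin n → ℝ → Ω → ℝ) (d : Fin n → ℝ → ℝ) (a b : ℝ) : ℝ≥0∞ :=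
  ∫⁻ w : Fin n → ℝ, ENNReal.ofReal (Real.exp (∑ i, w i)) *
    P {ω | ∃ t ∈ Set.Icc a b, ∀ i, √2 * Y i t ω - Var[Y i t; P] - d i t > w i}

/-- `H_{CB}(S) = H_{CB,0}[0,S]`, where `CB = (C₁B₁, …, CₙBₙ)` is the componentwise product. -/
noncomputable def pickandsIntegral {Ω : Type*} [MeasurableSpace Ω] {n : ℕ}
    (P : Measure Ω) (C : Fin n → ℝ) (B : Fin n → ℝ → Ω → ℝ) (S : ℝ) : ℝ≥0∞ :=
  pickandsPiterbargIntegral P (fun i t ω ↦ C i * B i t ω) (fun _ _ ↦ 0) 0 S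

/-- The multidimensional Pickands constant `H_{CB} = lim_{S → ∞} S⁻¹ H_{CB}(S)`, in `[0,∞]`
(of use only where this limit is known to exist). -/
noncomputable def pickandsConstant {Ω : Type*} [MeasurableSpace Ω] {n : ℕ}
    (P : Measure Ω) (C : Fin n → ℝ) (B : Fin n → ℝ → Ω → ℝ) : ℝ≥0∞ :=
  limUnder atTop fun S : ℝ ↦ ENNReal.ofReal S⁻¹ * pickandsIntegral P C B S

/-!
Write `Zᵢ(t) = √2 Cᵢ Bᵢ(t) - Cᵢ² |t|^κ` and let `M = P ⊗ e^{w₁ + ⋯ + wₙ} dw`. By Tonelli's theorem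
the Pickands integral is the `M`-measure of the union over `t ∈ [0, S]` of the sets
`A(t) = {(ω, w) | w < Z(t, ω)}`, and by continuity of the paths only countably many times matter
(`pickandsIntegral_eq_exceedance`). Everything else uses only the Laplace transforms
`E exp (∑ᵢ ∑ₖ aᵢₖ Zᵢ(τₖ))`, whose logarithms (`laplaceExponent`) are invariant under translations of the times
`τₖ` as soon as `∑ₖ aᵢₖ = 1` for each `i`.

* Stationarity: factoring `exp (∑ᵢ Zᵢ(p))` out of the measure of a finite union leaves a
  functional of the increments `Z(τₖ) - Z(p)`. Their law under the density `exp (∑ᵢ Zᵢ(p))` has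
  Laplace transforms with weights of sum `1`, hence is translation invariant
  (`tiltedIncrementLaw_add_right`), and so is the measure of the union
  (`exceedance_image_add_right`).
* Finiteness on `[0, 1]`: passing from one dyadic grid to the next one costs a small lowering of
  the level `w`, which multiplies `M` by a factor close to `1`, and an error which the exponential
  Markov inequality makes summable (`exceedance_dyadicGrid_succ_le`).
* Existence of the limit: stationarity makes the Pickands integral subadditive in `S`; it is
  monotone and finite, so Fekete's lemma applies (`exists_tendsto_inv_mul_of_subadditive`).
* Lower bound: `M(A(t)) = 1`, and `M(A(s) ∩ A(t)) ≤ exp (-(∑ᵢ Cᵢ² / 4) |s - t|^κ)` because a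
  minimum is at most a mean (`prod_exceedanceSet_inter_le`). The second moment method on a grid of
  mesh `δ` bounds the constant below by `1 / (δ + 2I)`, where
  `I = ∫₀^∞ exp (-(∑ᵢ Cᵢ² / 4) u^κ) du = (∑ᵢ Cᵢ² / 4)^(-1/κ) Γ(1/κ + 1)`. The choice `δ = 2I` gives `1 / (4I)`, which is the stated
  bound.
-/

/-! ### The exponential measure on `ℝⁿ` -/

/-- The measure `e^{w₁ + ⋯ + wₙ} dw` on `ℝⁿ`. -/
noncomputable def expWeight (n : ℕ) : Measure (Fin n → ℝ) :=
  volume.withDensity fun w ↦ ENNReal.ofReal (Real.exp (∑ i, w i))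

instance (n : ℕ) : SFinite (expWeight n) := by unfold expWeight; infer_instance

/-- The open lower orthant with vertex `z`. -/
def lowerOrthant {n : ℕ} (z : Fin n → ℝ) : Set (Fin n → ℝ) := {w | ∀ i, w i < z i}

lemma expWeight_lowerOrthant {n : ℕ} (z : Fin n → ℝ) :
    expWeight n (lowerOrthant z) = ENNReal.ofReal (Real.exp (∑ i, z i)) := by
  have hset : lowerOrthant z = Set.univ.pi fun i ↦ Set.Iio (z i) := by
    ext w; simp [lowerOrthant]
  have hmeas : MeasurableSet (lowerOrthant z) := by
    rw [hset]; exact MeasurableSet.univ_pi fun i ↦ measurableSet_Iio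
  have hint : ∀ i, Integrable ((Set.Iio (z i)).indicator Real.exp) := fun i ↦
    ((integrableOn_exp_Iic (z i)).mono_set Set.Iio_subset_Iic_self).integrable_indicator
      measurableSet_Iio
  have hind : ∀ w : Fin n → ℝ, (lowerOrthant z).indicator
      (fun w ↦ ENNReal.ofReal (Real.exp (∑ i, w i))) w
      = ENNReal.ofReal (∏ i, (Set.Iio (z i)).indicator Real.exp (w i)) := by
    intro w
    by_cases hw : w ∈ lowerOrthant z
    · have : ∀ i, (Set.Iio (z i)).indicator Real.exp (w i) = Real.exp (w i) := fun i ↦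
        Set.indicator_of_mem (Set.mem_Iio.2 (hw i)) _
      simp [Set.indicator_of_mem hw, this, Real.exp_sum]
    · rw [Set.indicator_of_notMem hw]
      simp only [lowerOrthant, Set.mem_ofPred_eq, not_forall] at hw
      obtain ⟨i, hi⟩ := hw
      have : (Set.Iio (z i)).indicator Real.exp (w i) = 0 :=
        Set.indicator_of_notMem (mt Set.mem_Iio.1 hi) _
      rw [Finset.prod_eq_zero (Finset.mem_univ i) this]
      simp
  rw [expWeight, withDensity_apply _ hmeas, ← lintegral_indicator hmeas]
  simp_rw [hind]
  rw [← ofReal_integral_eq_lintegral_ofReal]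
  · rw [integral_fintype_prod_volume_eq_prod (fun i ↦ (Set.Iio (z i)).indicator Real.exp),
      Real.exp_sum]
    congr 1
    refine Finset.prod_congr rfl fun i _ ↦ ?_
    rw [integral_indicator measurableSet_Iio, ← integral_Iic_eq_integral_Iio, integral_exp_Iic]
  · exact Integrable.fintype_prod (f := fun i ↦ (Set.Iio (z i)).indicator Real.exp) hint
  · refine Eventually.of_forall fun w ↦ Finset.prod_nonneg fun i _ ↦ ?_
    exact Set.indicator_nonneg (fun _ _ ↦ (Real.exp_pos _).le) _

lemma expWeight_preimage_sub {n : ℕ} (c : Fin n → ℝ) {s : Set (Fin n → ℝ)}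
    (hs : MeasurableSet s) :
    expWeight n ((fun w ↦ w - c) ⁻¹' s)
      = ENNReal.ofReal (Real.exp (∑ i, c i)) * expWeight n s := by
  have hs' : MeasurableSet ((fun w ↦ w - c) ⁻¹' s) := hs.preimage (by fun_prop)
  have key : ∀ w : Fin n → ℝ, ((fun w ↦ w - c) ⁻¹' s).indicator
      (fun w ↦ ENNReal.ofReal (Real.exp (∑ i, w i))) w
      = ENNReal.ofReal (Real.exp (∑ i, c i)) *
        s.indicator (fun w ↦ ENNReal.ofReal (Real.exp (∑ i, w i))) (w - c) := by
    intro w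
    by_cases hw : w - c ∈ s
    · rw [Set.indicator_of_mem (show w ∈ (fun w ↦ w - c) ⁻¹' s from hw), Set.indicator_of_mem hw,
        ← ENNReal.ofReal_mul (Real.exp_pos _).le, ← Real.exp_add]
      simp
    · rw [Set.indicator_of_notMem (show w ∉ (fun w ↦ w - c) ⁻¹' s from hw),
        Set.indicator_of_notMem hw, mul_zero]
  rw [expWeight, withDensity_apply _ hs', withDensity_apply _ hs, ← lintegral_indicator hs',
    ← lintegral_indicator hs]
  simp_rw [key]
  rw [lintegral_const_mul' _ _ ENNReal.ofReal_ne_top,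
    lintegral_sub_right_eq_self (fun w ↦ s.indicator
      (fun w : Fin n → ℝ ↦ ENNReal.ofReal (Real.exp (∑ i, w i))) w) c]

/-! ### Laplace transforms of fractional Brownian fields -/

/-- The logarithm of `E exp (∑ₖ aₖ (√2 B(τₖ) - |τₖ|^κ))` for a standard fractional Brownian
motion `B` with Hurst index `κ / 2`. It is invariant under translations of `τ` when the weights
`a` sum to `1`. -/
noncomputable def laplaceExponent (κ : ℝ) {K : Type} [Fintype K] (τ a : K → ℝ) : ℝ :=
  (∑ k, a k - 1) * ∑ k, a k * |τ k| ^ κ - (∑ k, ∑ l, a k * a l * |τ k - τ l| ^ κ) / 2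

/-- The field `Z` is measurable and has the finite-dimensional Laplace transforms of
`(√2 cᵢ Bᵢ(t) - cᵢ² |t|^κ)`, for independent standard fractional Brownian motions `Bᵢ` with Hurst
index `κ / 2`. No path regularity is asked for. -/
structure IsDriftedFractionalField {Ω : Type*} [MeasurableSpace Ω] {n : ℕ} (κ : ℝ)
    (c : Fin n → ℝ) (Z : Fin n → ℝ → Ω → ℝ) (P : Measure Ω) : Prop where
  measurable : ∀ i t, Measurable (Z i t)
  lintegral_exp : ∀ {K : Type} [Fintype K] (τ : K → ℝ) (a : Fin n → K → ℝ),
    ∫⁻ ω, ENNReal.ofReal (Real.exp (∑ i, ∑ k, a i k * Z i (τ k) ω)) ∂P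
      = ENNReal.ofReal (Real.exp (∑ i, c i ^ 2 * laplaceExponent κ τ (a i)))

section FractionalBrownianMotion

variable {Ω : Type*} [MeasurableSpace Ω] {P : Measure Ω} {n : ℕ} {κ : ℝ}

lemma IsFractionalBrownianMotion.mgf_sum [IsProbabilityMeasure P] {X : ℝ → Ω → ℝ}
    (hX : IsFractionalBrownianMotion (κ / 2) X P) {K : Type} [Fintype K] (τ a : K → ℝ) :
    mgf (fun ω ↦ ∑ k, a k * X (τ k) ω) P 1 =
      Real.exp ((∑ k, a k) / 2 * (∑ k, a k * |τ k| ^ κ)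
        - (∑ k, ∑ l, a k * a l * |τ k - τ l| ^ κ) / 4) := by
  classical
  have hL2 : ∀ t, MemLp (X t) 2 P := fun t ↦ (hX.isGaussianProcess.hasGaussianLaw_eval t).memLp_two
  have hgauss : HasGaussianLaw (fun ω ↦ ∑ k, a k * X (τ k) ω) P := by
    let I : Finset ℝ := Finset.univ.image τ
    have hI : ∀ k, τ k ∈ I := fun k ↦ Finset.mem_image_of_mem _ (Finset.mem_univ _)
    let L : (I → ℝ) →L[ℝ] ℝ := ∑ k, a k • ContinuousLinearMap.proj (⟨τ k, hI k⟩ : I)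
    have := (hX.isGaussianProcess.hasGaussianLaw I).map_fun L
    have hL : ∀ ω, L (I.restrict (X · ω)) = ∑ k, a k * X (τ k) ω := fun ω ↦ by
      simp [L]
    simpa only [hL] using this
  have hmean : ∫ ω, ∑ k, a k * X (τ k) ω ∂P = 0 := by
    rw [integral_finsetSum _ fun k _ ↦ ((hL2 (τ k)).integrable (by norm_num)).const_mul (a k)]
    simp [integral_const_mul, hX.integral_eq_zero]
  have hvar : Var[fun ω ↦ ∑ k, a k * X (τ k) ω; P]
      = (∑ k, a k) * (∑ k, a k * |τ k| ^ κ) - (∑ k, ∑ l, a k * a l * |τ k - τ l| ^ κ) / 2 := by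
    rw [← covariance_self hgauss.aemeasurable,
      covariance_fun_sum_fun_sum (fun k ↦ (hL2 (τ k)).const_mul (a k))
        (fun k ↦ (hL2 (τ k)).const_mul (a k))]
    simp_rw [covariance_const_mul_left, covariance_const_mul_right, hX.covariance_eq]
    have e : 2 * (κ / 2) = κ := by ring
    rw [e]
    have : ∀ k l, a k * (a l * ((|τ k| ^ κ + |τ l| ^ κ - |τ k - τ l| ^ κ) / 2))
        = a k * |τ k| ^ κ * a l / 2 + a k * (a l * |τ l| ^ κ) / 2
          - a k * a l * |τ k - τ l| ^ κ / 2 := by intros; ring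
    simp_rw [this, Finset.sum_sub_distrib, Finset.sum_add_distrib, ← Finset.sum_div,
      ← Finset.mul_sum, ← Finset.sum_mul]
    ring
  rw [mgf_gaussianReal hgauss.map_eq_gaussianReal, hmean, Real.coe_toNNReal _ (variance_nonneg _ _),
    hvar]
  congr 1
  ring

lemma IsFractionalBrownianMotion.variance_const_mul [IsProbabilityMeasure P] {X : ℝ → Ω → ℝ}
    (hκ : 0 < κ) (hX : IsFractionalBrownianMotion (κ / 2) X P) (c t : ℝ) :
    Var[fun ω ↦ c * X t ω; P] = c ^ 2 * |t| ^ κ := by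
  rw [ProbabilityTheory.variance_const_mul,
    ← covariance_self (hX.isGaussianProcess.aemeasurable t), hX.covariance_eq,
    show 2 * (κ / 2) = κ by ring, sub_self, abs_zero, Real.zero_rpow hκ.ne']
  ring

lemma IsVectorFractionalBrownianMotion.aemeasurable {h : ℝ} {B : Fin n → ℝ → Ω → ℝ}
    (hB : IsVectorFractionalBrownianMotion h B P) (i : Fin n) (t : ℝ) :
    AEMeasurable (B i t) P := by
  have hX := hB.isFractionalBrownianMotion i
  exact hX.isGaussianProcess.aemeasurable t

/-- The field `√2 cᵢ Bᵢ(t) - cᵢ² |t|^κ`, made measurable by choosing a measurable version of `Bᵢ(t)`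
separately for each `t`. It agrees with the original field almost surely on countable sets of times,
but its paths need not be continuous. -/
noncomputable def driftedField (P : Measure Ω) (κ : ℝ) (c : Fin n → ℝ)
    (B : Fin n → ℝ → Ω → ℝ) (hB : ∀ i t, AEMeasurable (B i t) P) (i : Fin n) (t : ℝ) (ω : Ω) : ℝ :=
  √2 * (c i * (hB i t).mk (B i t) ω) - c i ^ 2 * |t| ^ κ

lemma IsVectorFractionalBrownianMotion.isDriftedFractionalField [IsProbabilityMeasure P]
    {B : Fin n → ℝ → Ω → ℝ} (hB : IsVectorFractionalBrownianMotion (κ / 2) B P)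
    (c : Fin n → ℝ) (hm : ∀ i t, AEMeasurable (B i t) P) :
    IsDriftedFractionalField κ c (driftedField P κ c B hm) P where
  measurable i t := by
    have := (hm i t).measurable_mk
    unfold driftedField
    fun_prop
  lintegral_exp {K} _ τ a := by
    let Y : Fin n → Ω → ℝ := fun i ω ↦ ∑ k, (√2 * c i * a i k) * B i (τ k) ω
    have hYm : ∀ i, AEMeasurable (Y i) P := fun i ↦
      Finset.aemeasurable_fun_sum _ fun k _ ↦ (hm i (τ k)).const_mul _
    have hind : iIndepFun Y P :=
      hB.independent.comp (fun i path ↦ ∑ k, (√2 * c i * a i k) * path (τ k))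
        fun i ↦ by fun_prop
    have hmgf := hind.mgf_sum₀ (t := 1) hYm Finset.univ
    have hsum : mgf (∑ i, Y i) P 1 = Real.exp (∑ i, (c i ^ 2 * laplaceExponent κ τ (a i)
        + c i ^ 2 * ∑ k, a i k * |τ k| ^ κ)) := by
      rw [hmgf, Real.exp_sum]
      refine Finset.prod_congr rfl fun i _ ↦ ?_
      simp only [Y]
      rw [(hB.isFractionalBrownianMotion i).mgf_sum]
      congr 1
      have h2 : √2 * √2 = 2 := Real.mul_self_sqrt (by norm_num)
      have e1 : ∀ k l, √2 * c i * a i k * (√2 * c i * a i l) * |τ k - τ l| ^ κ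
          = 2 * c i ^ 2 * (a i k * a i l * |τ k - τ l| ^ κ) := fun k l ↦ by
        linear_combination (c i ^ 2 * a i k * a i l * |τ k - τ l| ^ κ) * h2
      simp_rw [e1, mul_assoc (√2 * c i), ← Finset.mul_sum]
      unfold laplaceExponent
      linear_combination
        (c i ^ 2 * (∑ k, a i k) / 2 * ∑ k, a i k * |τ k| ^ κ) * h2
    have hae : ∀ᵐ ω ∂P, ∀ i k, (hm i (τ k)).mk (B i (τ k)) ω = B i (τ k) ω := by
      refine ae_all_iff.2 fun i ↦ ae_all_iff.2 fun k ↦ ?_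
      exact (hm i (τ k)).ae_eq_mk.symm
    have hint : Integrable (fun ω ↦ Real.exp (1 * (∑ i, Y i) ω)) P := by
      rw [← mgf_pos_iff, hsum]
      exact Real.exp_pos _
    have hcongr : ∀ᵐ ω ∂P, ENNReal.ofReal (Real.exp (∑ i, ∑ k, a i k *
        driftedField P κ c B hm i (τ k) ω))
        = ENNReal.ofReal (Real.exp (-∑ i, c i ^ 2 * ∑ k, a i k * |τ k| ^ κ)) *
          ENNReal.ofReal (Real.exp (1 * (∑ i, Y i) ω)) := by
      filter_upwards [hae] with ω hω
      rw [← ENNReal.ofReal_mul (Real.exp_pos _).le, ← Real.exp_add]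
      congr 2
      rw [one_mul, Finset.sum_apply, neg_add_eq_sub, ← Finset.sum_sub_distrib]
      refine Finset.sum_congr rfl fun i _ ↦ ?_
      simp only [Y]
      rw [Finset.mul_sum, ← Finset.sum_sub_distrib]
      refine Finset.sum_congr rfl fun k _ ↦ ?_
      rw [driftedField, hω i k]
      ring
    rw [lintegral_congr_ae hcongr, lintegral_const_mul' _ _ ENNReal.ofReal_ne_top,
      ← ofReal_integral_eq_lintegral_ofReal hint (Eventually.of_forall fun _ ↦ (Real.exp_pos _).le)]
    change _ * ENNReal.ofReal (mgf (∑ i, Y i) P 1) = _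
    rw [hsum, ← ENNReal.ofReal_mul (Real.exp_pos _).le, ← Real.exp_add, Finset.sum_add_distrib]
    congr 2
    ring

end FractionalBrownianMotion

/-! ### Exceedance measures -/

section Exceedance

variable {Ω : Type*} [MeasurableSpace Ω] {P : Measure Ω} {n : ℕ} {κ : ℝ} {c : Fin n → ℝ}
  {Z : Fin n → ℝ → Ω → ℝ}

/-- The pairs `(ω, w)` such that `Z(t)` exceeds the level `w` in every coordinate. -/
def exceedanceSet (Z : Fin n → ℝ → Ω → ℝ) (t : ℝ) : Set (Ω × (Fin n → ℝ)) :=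
  {p | p.2 ∈ lowerOrthant fun i ↦ Z i t p.1}

/-- The mass, for `P ⊗ e^{w₁ + ⋯ + wₙ} dw`, of the pairs `(ω, w)` such that `Z` exceeds the level
`w` at some time in `T`. -/
noncomputable def exceedance (P : Measure Ω) (Z : Fin n → ℝ → Ω → ℝ) (T : Set ℝ) : ℝ≥0∞ :=
  (P.prod (expWeight n)) (⋃ t ∈ T, exceedanceSet Z t)

lemma exceedance_mono {S T : Set ℝ} (h : S ⊆ T) : exceedance P Z S ≤ exceedance P Z T :=
  measure_mono (Set.biUnion_subset_biUnion_left h)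

lemma exceedance_union_le (S T : Set ℝ) :
    exceedance P Z (S ∪ T) ≤ exceedance P Z S + exceedance P Z T := by
  unfold exceedance
  rw [Set.biUnion_union]
  exact measure_union_le _ _

lemma measurableSet_lowerOrthant (z : Fin n → ℝ) : MeasurableSet (lowerOrthant z) := by
  unfold lowerOrthant
  measurability

namespace IsDriftedFractionalField

lemma measurableSet_exceedanceSet (hZ : IsDriftedFractionalField κ c Z P) (t : ℝ) :
    MeasurableSet (exceedanceSet Z t) := by
  have : exceedanceSet Z t = ⋂ i, {p | p.2 i < Z i t p.1} := by
    ext; simp [exceedanceSet, lowerOrthant]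
  rw [this]
  refine MeasurableSet.iInter fun i ↦ measurableSet_lt (by fun_prop) ?_
  exact (hZ.measurable i t).comp measurable_fst

lemma measurableSet_biUnion (hZ : IsDriftedFractionalField κ c Z P) {T : Set ℝ}
    (hT : T.Countable) : MeasurableSet (⋃ t ∈ T, exceedanceSet Z t) :=
  MeasurableSet.biUnion hT fun t _ ↦ hZ.measurableSet_exceedanceSet t

lemma prod_exceedanceSet [IsProbabilityMeasure P] (hZ : IsDriftedFractionalField κ c Z P)
    (hκ : 0 < κ) (t : ℝ) : (P.prod (expWeight n)) (exceedanceSet Z t) = 1 := by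
  rw [Measure.prod_apply (hZ.measurableSet_exceedanceSet t)]
  have h : ∀ ω, expWeight n (Prod.mk ω ⁻¹' exceedanceSet Z t)
      = ENNReal.ofReal (Real.exp (∑ i, ∑ _k : Unit, 1 * Z i t ω)) := fun ω ↦ by
    simp only [Finset.univ_unique, Finset.sum_singleton, one_mul]
    exact expWeight_lowerOrthant fun i ↦ Z i t ω
  simp_rw [h]
  rw [hZ.lintegral_exp (fun _ : Unit ↦ t) (fun _ _ ↦ 1)]
  simp [laplaceExponent, Real.zero_rpow hκ.ne']

/-- Two exceedances at distant times are nearly disjoint: the minimum of two numbers is at most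
their mean, whose Laplace transform is explicit. -/
lemma prod_exceedanceSet_inter_le (hZ : IsDriftedFractionalField κ c Z P) (hκ : 0 < κ) (s t : ℝ) :
    (P.prod (expWeight n)) (exceedanceSet Z s ∩ exceedanceSet Z t)
      ≤ ENNReal.ofReal (Real.exp (-((∑ i, c i ^ 2) / 4 * |s - t| ^ κ))) := by
  rw [Measure.prod_apply
    ((hZ.measurableSet_exceedanceSet s).inter (hZ.measurableSet_exceedanceSet t))]
  have h : ∀ ω, expWeight n (Prod.mk ω ⁻¹' (exceedanceSet Z s ∩ exceedanceSet Z t))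
      ≤ ENNReal.ofReal (Real.exp (∑ i, ∑ k : Fin 2, 1 / 2 * Z i (![s, t] k) ω)) := fun ω ↦ by
    have : Prod.mk ω ⁻¹' (exceedanceSet Z s ∩ exceedanceSet Z t)
        ⊆ lowerOrthant fun i ↦ ∑ k : Fin 2, 1 / 2 * Z i (![s, t] k) ω := by
      rintro w ⟨h1, h2⟩ i
      have h1' : w i < Z i s ω := h1 i
      have h2' : w i < Z i t ω := h2 i
      simp only [Fin.sum_univ_two, Matrix.cons_val_zero, Matrix.cons_val_one]
      linarith
    exact (measure_mono this).trans (expWeight_lowerOrthant _).le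
  refine (lintegral_mono h).trans (hZ.lintegral_exp ![s, t] (fun _ _ ↦ 1 / 2)).le |>.trans_eq ?_
  congr 2
  rw [← Finset.sum_mul, laplaceExponent]
  simp only [Fin.sum_univ_two, Matrix.cons_val_zero, Matrix.cons_val_one, sub_self, abs_zero,
    Real.zero_rpow hκ.ne', abs_sub_comm t s]
  ring

end IsDriftedFractionalField

/-! ### Translation invariance -/

/-- Finite measures on `ℝᴷ` with the same finite Laplace transform are equal. -/
lemma MeasureTheory.Measure.ext_of_lintegral_exp {K : Type*} [Fintype K] {μ ν : Measure (K → ℝ)}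
    [IsFiniteMeasure μ] [IsFiniteMeasure ν]
    (h : ∀ a : K → ℝ, ∫⁻ x, ENNReal.ofReal (Real.exp (∑ k, a k * x k)) ∂μ
      = ∫⁻ x, ENNReal.ofReal (Real.exp (∑ k, a k * x k)) ∂ν)
    (hfin : ∀ a : K → ℝ, ∫⁻ x, ENNReal.ofReal (Real.exp (∑ k, a k * x k)) ∂μ ≠ ∞) :
    μ = ν := by
  classical
  refine Measure.ext_of_charFunDual (funext fun L ↦ ?_)
  let b : K → ℝ := fun k ↦ L (Pi.single k 1)
  have hL : ∀ x, L x = ∑ k, b k * x k := fun x ↦ by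
    conv_lhs => rw [← Finset.univ_sum_single x, _root_.map_sum]
    refine Finset.sum_congr rfl fun k _ ↦ ?_
    rw [show Pi.single k (x k) = x k • (Pi.single k 1 : K → ℝ) by simp [← Pi.single_smul],
      _root_.map_smul, smul_eq_mul, mul_comm]
  have hexp : ∀ (t : ℝ) x, Real.exp (t * L x) = Real.exp (∑ k, (t * b k) * x k) := fun t x ↦ by
    rw [hL, Finset.mul_sum]
    simp_rw [mul_assoc]
  have hLm : ∀ t : ℝ, Measurable fun x ↦ Real.exp (t * L x) := fun t ↦ by fun_prop
  have hmgf : mgf L μ = mgf L ν := funext fun t ↦ by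
    unfold mgf
    rw [integral_eq_lintegral_of_nonneg_ae (Eventually.of_forall fun _ ↦ (Real.exp_pos _).le)
        (hLm t).aestronglyMeasurable,
      integral_eq_lintegral_of_nonneg_ae (Eventually.of_forall fun _ ↦ (Real.exp_pos _).le)
        (hLm t).aestronglyMeasurable]
    simp_rw [hexp]
    rw [h]
  have hset : integrableExpSet L μ = Set.univ := by
    refine Set.eq_univ_of_forall fun t ↦ ?_
    refine ⟨(hLm t).aestronglyMeasurable, ?_⟩
    rw [hasFiniteIntegral_iff_ofReal (Eventually.of_forall fun _ ↦ (Real.exp_pos _).le)]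
    simp_rw [hexp]
    exact (hfin _).lt_top
  have hzero : μ = 0 ↔ ν = 0 := by
    have h0 : μ Set.univ = ν Set.univ := by simpa using h 0
    rw [← Measure.measure_univ_eq_zero, h0, Measure.measure_univ_eq_zero]
  have hc := eqOn_complexMGF_of_mgf' hmgf hzero (x := (Complex.I : ℂ)) (by simp [hset])
  rw [charFunDual_apply, charFunDual_apply]
  simp only [complexMGF] at hc
  simpa only [mul_comm Complex.I] using hc

/-- The law of the increments `Z(τₖ) - Z(p)` after the change of measure with density
`exp (∑ᵢ Zᵢ(p))`. -/
noncomputable def tiltedIncrementLaw (P : Measure Ω) (Z : Fin n → ℝ → Ω → ℝ) {K : Type}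
    (τ : K → ℝ) (p : ℝ) : Measure (Fin n × K → ℝ) :=
  (P.withDensity fun ω ↦ ENNReal.ofReal (Real.exp (∑ i, Z i p ω))).map
    fun ω j ↦ Z j.1 (τ j.2) ω - Z j.1 p ω

namespace IsDriftedFractionalField

lemma measurable_increments (hZ : IsDriftedFractionalField κ c Z P) {K : Type} (τ : K → ℝ) (p : ℝ) :
    Measurable fun ω (j : Fin n × K) ↦ Z j.1 (τ j.2) ω - Z j.1 p ω :=
  measurable_pi_lambda _ fun j ↦ (hZ.measurable j.1 _).sub (hZ.measurable j.1 _)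

lemma measurable_density (hZ : IsDriftedFractionalField κ c Z P) (p : ℝ) :
    Measurable fun ω ↦ ENNReal.ofReal (Real.exp (∑ i, Z i p ω)) := by
  have := fun i ↦ hZ.measurable i p
  fun_prop

lemma lintegral_tiltedIncrementLaw (hZ : IsDriftedFractionalField κ c Z P) {K : Type}
    (τ : K → ℝ) (p : ℝ) {g : (Fin n × K → ℝ) → ℝ≥0∞} (hg : Measurable g) :
    ∫⁻ x, g x ∂tiltedIncrementLaw P Z τ p
      = ∫⁻ ω, ENNReal.ofReal (Real.exp (∑ i, Z i p ω)) *
          g (fun j ↦ Z j.1 (τ j.2) ω - Z j.1 p ω) ∂P := by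
  rw [tiltedIncrementLaw, lintegral_map hg (hZ.measurable_increments τ p)]
  exact lintegral_withDensity_eq_lintegral_mul P (hZ.measurable_density p)
    (hg.comp (hZ.measurable_increments τ p))

lemma lintegral_exp_tiltedIncrementLaw (hZ : IsDriftedFractionalField κ c Z P) {K : Type}
    [Fintype K] (τ : K → ℝ) (p : ℝ) (b : Fin n × K → ℝ) :
    ∫⁻ x, ENNReal.ofReal (Real.exp (∑ j, b j * x j)) ∂tiltedIncrementLaw P Z τ p
      = ENNReal.ofReal (Real.exp (∑ i, c i ^ 2 *
          laplaceExponent κ (fun k : Option K ↦ k.elim p τ)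
            (fun k ↦ k.elim (1 - ∑ k, b (i, k)) fun k ↦ b (i, k)))) := by
  have hg : Measurable fun x : Fin n × K → ℝ ↦
      ENNReal.ofReal (Real.exp (∑ j, b j * x j)) := by fun_prop
  rw [← hZ.lintegral_exp, hZ.lintegral_tiltedIncrementLaw τ p hg]
  refine lintegral_congr fun ω ↦ ?_
  rw [← ENNReal.ofReal_mul (Real.exp_pos _).le, ← Real.exp_add]
  congr 2
  rw [Fintype.sum_prod_type, ← Finset.sum_add_distrib]
  refine Finset.sum_congr rfl fun i _ ↦ ?_
  simp only [Fintype.sum_option, Option.elim, mul_sub, Finset.sum_sub_distrib, ← Finset.sum_mul]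
  ring

lemma laplaceExponent_add_right {K : Type} [Fintype K] (τ a : K → ℝ) (ha : ∑ k, a k = 1) (s : ℝ) :
    laplaceExponent κ (fun k ↦ τ k + s) a = laplaceExponent κ τ a := by
  simp [laplaceExponent, ha]

/-- The Cameron–Martin computation: after the change of measure, the law of the increments does
not depend on the origin of time. -/
lemma tiltedIncrementLaw_add_right (hZ : IsDriftedFractionalField κ c Z P) {K : Type} [Fintype K]
    (τ : K → ℝ) (p s : ℝ) :
    tiltedIncrementLaw P Z (fun k ↦ τ k + s) (p + s) = tiltedIncrementLaw P Z τ p := by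
  have hfin : ∀ (τ : K → ℝ) (p : ℝ), IsFiniteMeasure (tiltedIncrementLaw P Z τ p) := fun τ p ↦ by
    refine ⟨?_⟩
    have := hZ.lintegral_exp_tiltedIncrementLaw τ p 0
    simp only [Pi.zero_apply, zero_mul, Finset.sum_const_zero, Real.exp_zero, ENNReal.ofReal_one,
      lintegral_one] at this
    rw [this]
    exact ENNReal.ofReal_lt_top
  have := hfin τ p
  have := hfin (fun k ↦ τ k + s) (p + s)
  refine Measure.ext_of_lintegral_exp (fun b ↦ ?_) fun b ↦ ?_
  · rw [hZ.lintegral_exp_tiltedIncrementLaw, hZ.lintegral_exp_tiltedIncrementLaw]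
    congr 2
    refine Finset.sum_congr rfl fun i _ ↦ ?_
    rw [← laplaceExponent_add_right (fun k : Option K ↦ k.elim p τ) _ _ s]
    · congr 2
      funext k
      cases k <;> rfl
    · simp [Fintype.sum_option]
  · rw [hZ.lintegral_exp_tiltedIncrementLaw]
    exact ENNReal.ofReal_ne_top

lemma exceedance_range (hZ : IsDriftedFractionalField κ c Z P) {K : Type} [Fintype K]
    (τ : K → ℝ) (p : ℝ) :
    exceedance P Z (Set.range τ) = ∫⁻ x, expWeight n (⋃ k, lowerOrthant fun i ↦ x (i, k))
      ∂tiltedIncrementLaw P Z τ p := by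
  have hG : Measurable fun x : Fin n × K → ℝ ↦
      expWeight n (⋃ k, lowerOrthant fun i ↦ x (i, k)) := by
    have : MeasurableSet (⋃ k, {q : (Fin n × K → ℝ) × (Fin n → ℝ) | ∀ i, q.2 i < q.1 (i, k)}) := by
      refine MeasurableSet.iUnion fun k ↦ ?_
      have : {q : (Fin n × K → ℝ) × (Fin n → ℝ) | ∀ i, q.2 i < q.1 (i, k)}
        = ⋂ i, {q | q.2 i < q.1 (i, k)} := by ext; simp
      rw [this]
      exact MeasurableSet.iInter fun i ↦ measurableSet_lt (by fun_prop) (by fun_prop)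
    convert measurable_measure_prodMk_left (ν := expWeight n) this using 3 with x
    ext w
    simp [lowerOrthant]
  rw [hZ.lintegral_tiltedIncrementLaw τ p hG, exceedance,
    Measure.prod_apply (hZ.measurableSet_biUnion (Set.finite_range τ).countable)]
  refine lintegral_congr fun ω ↦ ?_
  rw [← expWeight_preimage_sub]
  · congr 1
    ext w
    simp [exceedanceSet, lowerOrthant]
  · exact MeasurableSet.iUnion fun k ↦ measurableSet_lowerOrthant _

/-- Stationarity of the exceedance measure. -/
lemma exceedance_image_add_right (hZ : IsDriftedFractionalField κ c Z P) (F : Finset ℝ) (s : ℝ) :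
    exceedance P Z ((fun t ↦ t + s) '' F) = exceedance P Z F := by
  have h1 : (F : Set ℝ) = Set.range ((↑) : F → ℝ) := by simp
  have h2 : (fun t ↦ t + s) '' F = Set.range fun k : F ↦ (k : ℝ) + s := by
    rw [h1, ← Set.range_comp]; rfl
  rw [h2, h1, hZ.exceedance_range _ (0 + s), hZ.exceedance_range _ 0,
    hZ.tiltedIncrementLaw_add_right]

end IsDriftedFractionalField

end Exceedance

/-! ### Reduction to countable sets of times -/

section Countable

variable {Ω : Type*} [MeasurableSpace Ω] {P : Measure Ω} {n : ℕ} {κ : ℝ} {c : Fin n → ℝ}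

/-- Countable sets of times are exhausted by their finite subsets. -/
lemma exceedance_le_of_forall_finset {Z : Fin n → ℝ → Ω → ℝ} {D : Set ℝ} (hD : D.Countable)
    {b : ℝ≥0∞} (h : ∀ F : Finset ℝ, (F : Set ℝ) ⊆ D → exceedance P Z F ≤ b) :
    exceedance P Z D ≤ b := by
  classical
  have := hD.to_subtype
  have hU : (⋃ t ∈ D, exceedanceSet Z t)
      = ⋃ F : Finset D, ⋃ t ∈ F, exceedanceSet Z (t : ℝ) := by
    ext p
    simp only [Set.mem_iUnion]
    constructor
    · rintro ⟨t, ht, hp⟩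
      exact ⟨{⟨t, ht⟩}, ⟨t, ht⟩, by simp, hp⟩
    · rintro ⟨F, t, -, hp⟩
      exact ⟨t, t.2, hp⟩
  have hdir : Directed (· ⊆ ·) fun F : Finset D ↦ ⋃ t ∈ F, exceedanceSet Z (t : ℝ) := by
    refine Monotone.directed_le fun F G hFG ↦ ?_
    exact Set.biUnion_subset_biUnion_left fun t ht ↦ hFG ht
  rw [exceedance, hU, hdir.measure_iUnion]
  refine iSup_le fun F ↦ ?_
  have hF : (F.map (Function.Embedding.subtype _) : Set ℝ) ⊆ D := by
    simp
  refine le_trans (measure_mono fun p hp ↦ ?_) (h _ hF)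
  simpa using hp

variable [IsProbabilityMeasure P]

/-- By almost sure continuity of the paths, only a countable dense set of times matters in the
Pickands integral, and Tonelli's theorem turns the integral into an exceedance measure. -/
lemma pickandsIntegral_eq_exceedance {B : Fin n → ℝ → Ω → ℝ} (hκ : 0 < κ)
    (hB : IsVectorFractionalBrownianMotion (κ / 2) B P) (hm : ∀ i t, AEMeasurable (B i t) P)
    {S : ℝ} {D : Set ℝ} (hD : D.Countable) (hDS : D ⊆ Set.Icc 0 S)
    (hSD : Set.Icc 0 S ⊆ closure D) :
    pickandsIntegral P c B S = exceedance P (driftedField P κ c B hm) D := by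
  have hZ := hB.isDriftedFractionalField c hm
  have hcont : ∀ᵐ ω ∂P, ∀ i, Continuous fun t ↦ B i t ω :=
    ae_all_iff.2 fun i ↦ (hB.isFractionalBrownianMotion i).continuous_paths
  have hmk : ∀ᵐ ω ∂P, ∀ t ∈ D, ∀ i, (hm i t).mk (B i t) ω = B i t ω :=
    (ae_ball_iff hD).2 fun t _ ↦ ae_all_iff.2 fun i ↦ (hm i t).ae_eq_mk.symm
  have hprob : ∀ w : Fin n → ℝ,
      P {ω | ∃ t ∈ Set.Icc 0 S, ∀ i,
        √2 * (c i * B i t ω) - Var[fun ω ↦ c i * B i t ω; P] - 0 > w i}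
      = P ((fun ω ↦ (ω, w)) ⁻¹' ⋃ t ∈ D, exceedanceSet (driftedField P κ c B hm) t) := by
    intro w
    refine measure_congr (eventuallyEq_set.2 ?_)
    filter_upwards [hcont, hmk] with ω hω hω'
    have hvar : ∀ i t, Var[fun ω ↦ c i * B i t ω; P] = c i ^ 2 * |t| ^ κ := fun i t ↦
      (hB.isFractionalBrownianMotion i).variance_const_mul hκ (c i) t
    have hiff : ω ∈ ((fun ω ↦ (ω, w)) ⁻¹'
        ⋃ t ∈ D, exceedanceSet (driftedField P κ c B hm) t) ↔
        ∃ t ∈ D, ∀ i, w i < √2 * (c i * B i t ω) - c i ^ 2 * |t| ^ κ := by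
      simp only [Set.mem_preimage, Set.mem_iUnion, exceedanceSet, lowerOrthant,
        Set.mem_ofPred_eq, driftedField, exists_prop]
      refine exists_congr fun t ↦ and_congr_right fun ht ↦ forall_congr' fun i ↦ ?_
      rw [hω' t ht i]
    rw [hiff]
    simp only [hvar, sub_zero, gt_iff_lt]
    constructor
    · rintro ⟨t, ht, htw⟩
      have hopen : IsOpen {t : ℝ | ∀ i, w i < √2 * (c i * B i t ω) - c i ^ 2 * |t| ^ κ} := by
        simp only [Set.ofPred_forall]
        refine isOpen_iInter_of_finite fun i ↦ isOpen_lt continuous_const ?_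
        have h1 := hω i
        have h2 : Continuous fun t : ℝ ↦ |t| ^ κ := continuous_abs.rpow_const fun _ ↦ Or.inr hκ.le
        fun_prop
      obtain ⟨s, hs, hsD⟩ := mem_closure_iff.1 (hSD ht) _ hopen htw
      exact ⟨s, hsD, hs⟩
    · rintro ⟨t, ht, htw⟩
      exact ⟨t, hDS ht, htw⟩
  unfold pickandsIntegral pickandsPiterbargIntegral
  simp_rw [hprob]
  rw [exceedance, Measure.prod_apply_symm (hZ.measurableSet_biUnion hD), expWeight]
  exact (lintegral_withDensity_eq_lintegral_mul volume (by fun_prop)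
    (measurable_measure_prodMk_right (hZ.measurableSet_biUnion hD))).symm

lemma exceedance_le_pickandsIntegral {B : Fin n → ℝ → Ω → ℝ} (hκ : 0 < κ)
    (hB : IsVectorFractionalBrownianMotion (κ / 2) B P) (hm : ∀ i t, AEMeasurable (B i t) P)
    {S : ℝ} {F : Finset ℝ} (hF : (F : Set ℝ) ⊆ Set.Icc 0 S) :
    exceedance P (driftedField P κ c B hm) F ≤ pickandsIntegral P c B S := by
  obtain ⟨D, hDS, hD, hSD⟩ :=
    (TopologicalSpace.IsSeparable.of_separableSpace (Set.Icc 0 S)).exists_countable_dense_subset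
  rw [pickandsIntegral_eq_exceedance hκ hB hm (hD.union F.countable_toSet)
    (Set.union_subset hDS hF) (hSD.trans (closure_mono Set.subset_union_left))]
  exact exceedance_mono Set.subset_union_right

lemma pickandsIntegral_le_of_forall_finset {B : Fin n → ℝ → Ω → ℝ} (hκ : 0 < κ)
    (hB : IsVectorFractionalBrownianMotion (κ / 2) B P) (hm : ∀ i t, AEMeasurable (B i t) P)
    {S : ℝ} {b : ℝ≥0∞} (h : ∀ F : Finset ℝ, (F : Set ℝ) ⊆ Set.Icc 0 S →
      exceedance P (driftedField P κ c B hm) F ≤ b) :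
    pickandsIntegral P c B S ≤ b := by
  obtain ⟨D, hDS, hD, hSD⟩ :=
    (TopologicalSpace.IsSeparable.of_separableSpace (Set.Icc 0 S)).exists_countable_dense_subset
  rw [pickandsIntegral_eq_exceedance hκ hB hm hD hDS hSD]
  exact exceedance_le_of_forall_finset hD fun F hF ↦ h F (hF.trans hDS)

end Countable

/-! ### Finiteness by dyadic chaining -/

section Chaining

variable {Ω : Type*} [MeasurableSpace Ω] {P : Measure Ω} {n : ℕ} {κ : ℝ} {c : Fin n → ℝ}
  {Z : Fin n → ℝ → Ω → ℝ}

/-- Lowering all levels by `d` multiplies the exceedance measure by `e^{nd}`. -/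
lemma IsDriftedFractionalField.prod_preimage_sub (hZ : IsDriftedFractionalField κ c Z P)
    {T : Set ℝ} (hT : T.Countable) (d : ℝ) :
    (P.prod (expWeight n)) ((fun p ↦ (p.1, p.2 - fun _ ↦ d)) ⁻¹' ⋃ t ∈ T, exceedanceSet Z t)
      = ENNReal.ofReal (Real.exp (n * d)) * exceedance P Z T := by
  have hm := hZ.measurableSet_biUnion hT
  rw [exceedance, Measure.prod_apply (hm.preimage (by fun_prop)), Measure.prod_apply hm,
    ← lintegral_const_mul _ (measurable_measure_prodMk_left hm)]
  refine lintegral_congr fun ω ↦ ?_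
  have := expWeight_preimage_sub (fun _ : Fin n ↦ d)
    (hm.preimage (measurable_prodMk_left (x := ω)))
  simp only [Finset.sum_const, Finset.card_univ, Fintype.card_fin, nsmul_eq_mul] at this
  rw [← this]
  rfl

/-- Exponential Markov inequality for the event that `Zᵢ` grows by `d` between `s` and an exceedance
at time `t`. -/
lemma IsDriftedFractionalField.prod_exceedanceSet_increment_le
    (hZ : IsDriftedFractionalField κ c Z P) (hκ : 0 < κ) (i : Fin n) (s t d : ℝ) {θ : ℝ}
    (hθ : 0 ≤ θ) :
    (P.prod (expWeight n)) (exceedanceSet Z t ∩ {p | d ≤ Z i t p.1 - Z i s p.1})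
      ≤ ENNReal.ofReal (Real.exp (c i ^ 2 * (θ * (1 + θ) * |t - s| ^ κ) - θ * d)) := by
  have hm : MeasurableSet {p : Ω × (Fin n → ℝ) | d ≤ Z i t p.1 - Z i s p.1} :=
    measurableSet_le measurable_const
      (((hZ.measurable i t).comp measurable_fst).sub ((hZ.measurable i s).comp measurable_fst))
  rw [Measure.prod_apply ((hZ.measurableSet_exceedanceSet t).inter hm)]
  let a : Fin n → Fin 2 → ℝ := fun j ↦ if j = i then ![1 + θ, -θ] else ![1, 0]
  have h : ∀ ω, expWeight n (Prod.mk ω ⁻¹'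
        (exceedanceSet Z t ∩ {p | d ≤ Z i t p.1 - Z i s p.1}))
      ≤ ENNReal.ofReal (Real.exp (-(θ * d))) *
        ENNReal.ofReal (Real.exp (∑ j, ∑ k, a j k * Z j (![t, s] k) ω)) := fun ω ↦ by
    by_cases hd : d ≤ Z i t ω - Z i s ω
    · have hsub : Prod.mk ω ⁻¹' (exceedanceSet Z t ∩ {p | d ≤ Z i t p.1 - Z i s p.1})
          ⊆ lowerOrthant fun j ↦ Z j t ω := fun w hw ↦ hw.1
      refine (measure_mono hsub).trans ((expWeight_lowerOrthant _).trans_le ?_)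
      rw [← ENNReal.ofReal_mul (Real.exp_pos _).le, ← Real.exp_add]
      gcongr
      have hj : ∀ j, ∑ k, a j k * Z j (![t, s] k) ω
          = Z j t ω + if j = i then θ * (Z i t ω - Z i s ω) else 0 := fun j ↦ by
        by_cases hji : j = i
        · subst hji; simp [a]; ring
        · simp [a, hji]
      simp_rw [hj, Finset.sum_add_distrib, Finset.sum_ite_eq', Finset.mem_univ, if_true]
      nlinarith
    · have hempty : Prod.mk ω ⁻¹' (exceedanceSet Z t ∩ {p | d ≤ Z i t p.1 - Z i s p.1}) = ∅ := by
        ext w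
        simp [hd]
      simp [hempty]
  refine (lintegral_mono h).trans_eq ?_
  rw [lintegral_const_mul' _ _ ENNReal.ofReal_ne_top, hZ.lintegral_exp,
    ← ENNReal.ofReal_mul (Real.exp_pos _).le, ← Real.exp_add]
  congr 2
  have hj : ∀ j, c j ^ 2 * laplaceExponent κ ![t, s] (a j)
      = if j = i then c i ^ 2 * (θ * (1 + θ) * |t - s| ^ κ) else 0 := fun j ↦ by
    by_cases hji : j = i
    · subst hji
      simp only [laplaceExponent, a, if_true, Fin.sum_univ_two, Matrix.cons_val_zero,
        Matrix.cons_val_one, sub_self, abs_zero, Real.zero_rpow hκ.ne', abs_sub_comm s t]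
      ring
    · simp [laplaceExponent, a, hji, Real.zero_rpow hκ.ne']
  simp_rw [hj, Finset.sum_ite_eq', Finset.mem_univ, if_true]
  ring

/-- One step of chaining: passing from the times `T` to a `δ`-dense set of times `T'` costs a
lowering of the levels by `d` and an error controlled by the exponential Markov inequality. -/
lemma IsDriftedFractionalField.exceedance_le_of_forall_exists
    (hZ : IsDriftedFractionalField κ c Z P) (hκ : 0 < κ) {T : Finset ℝ} {T' : Set ℝ}
    (hT' : T'.Countable) {δ : ℝ} (hT : ∀ t ∈ T, ∃ s ∈ T', |t - s| ≤ δ) (d : ℝ) {θ : ℝ}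
    (hθ : 0 ≤ θ) :
    exceedance P Z T ≤ ENNReal.ofReal (Real.exp (n * d)) * exceedance P Z T' +
      T.card * ENNReal.ofReal (∑ i, Real.exp (c i ^ 2 * (θ * (1 + θ) * δ ^ κ) - θ * d)) := by
  choose! f hfT hf using hT
  have hsub : (⋃ t ∈ (T : Set ℝ), exceedanceSet Z t)
      ⊆ ((fun p ↦ (p.1, p.2 - fun _ ↦ d)) ⁻¹' ⋃ t ∈ T', exceedanceSet Z t) ∪
        ⋃ t ∈ T, ⋃ i, exceedanceSet Z t ∩ {p | d ≤ Z i t p.1 - Z i (f t) p.1} := by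
    intro p hp
    simp only [Set.mem_iUnion, Finset.mem_coe, exists_prop] at hp
    obtain ⟨t, ht, hp⟩ := hp
    by_cases h : ∃ i, d ≤ Z i t p.1 - Z i (f t) p.1
    · obtain ⟨i, hi⟩ := h
      refine Or.inr (Set.mem_biUnion (x := t) ht ?_)
      exact Set.mem_iUnion_of_mem i ⟨hp, hi⟩
    · push Not at h
      refine Or.inl (Set.mem_biUnion (x := f t) (hfT t ht) fun i ↦ ?_)
      have h1 : p.2 i < Z i t p.1 := hp i
      have h2 := h i
      change p.2 i - d < Z i (f t) p.1
      linarith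
  refine (measure_mono hsub).trans ((measure_union_le _ _).trans ?_)
  rw [hZ.prod_preimage_sub hT']
  gcongr
  refine (measure_biUnion_finset_le T _).trans ?_
  rw [← nsmul_eq_mul]
  refine Finset.sum_le_card_nsmul _ _ _ fun t ht ↦ ?_
  refine (measure_iUnion_fintype_le _ _).trans ?_
  rw [ENNReal.ofReal_sum_of_nonneg fun i _ ↦ (Real.exp_pos _).le]
  refine Finset.sum_le_sum fun i _ ↦
    (hZ.prod_exceedanceSet_increment_le hκ i (f t) t d hθ).trans ?_
  have := hf t ht
  gcongr

/-- The dyadic points `j / 2ᴷ` of `[0, 1]`. -/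
noncomputable def dyadicGrid (K : ℕ) : Finset ℝ :=
  (Finset.range (2 ^ K + 1)).image fun j : ℕ ↦ (j : ℝ) / 2 ^ K

lemma card_dyadicGrid_le (K : ℕ) : (dyadicGrid K).card ≤ 2 ^ (K + 1) := by
  refine Finset.card_image_le.trans ?_
  rw [Finset.card_range, pow_succ]
  have := Nat.one_le_two_pow (n := K)
  omega

lemma exists_mem_dyadicGrid {K : ℕ} {t : ℝ} (ht : t ∈ dyadicGrid (K + 1)) :
    ∃ s ∈ dyadicGrid K, |t - s| ≤ (1 / 2) ^ (K + 1) := by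
  simp only [dyadicGrid, Finset.mem_image, Finset.mem_range] at ht ⊢
  obtain ⟨j, hj, rfl⟩ := ht
  refine ⟨_, ⟨j / 2, by rw [pow_succ] at hj; omega, rfl⟩, ?_⟩
  have h1 : (j : ℝ) = 2 * (j / 2 : ℕ) + (j % 2 : ℕ) := by exact_mod_cast (Nat.div_add_mod j 2).symm
  have h2 : ((j % 2 : ℕ) : ℝ) ≤ 1 := by exact_mod_cast Nat.le_of_lt_succ (Nat.mod_lt j two_pos)
  have h3 : (j : ℝ) / 2 ^ (K + 1) - ((j / 2 : ℕ) : ℝ) / 2 ^ K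
      = ((j % 2 : ℕ) : ℝ) * (1 / 2) ^ (K + 1) := by
    rw [h1, one_div, inv_pow, pow_succ]
    field_simp
    simp
  rw [h3, abs_of_nonneg (by positivity)]
  exact mul_le_of_le_one_left (by positivity) h2

lemma subset_closure_iUnion_dyadicGrid :
    Set.Icc (0 : ℝ) 1 ⊆ closure (⋃ K, (dyadicGrid K : Set ℝ)) := by
  intro x hx
  refine mem_closure_of_tendsto (f := fun K : ℕ ↦ (⌊x * 2 ^ K⌋₊ : ℝ) / 2 ^ K) (b := atTop) ?_ ?_
  · exact (tendsto_nat_floor_mul_div_atTop hx.1).comp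
      (tendsto_pow_atTop_atTop_of_one_lt one_lt_two)
  · refine Eventually.of_forall fun K ↦ Set.mem_iUnion_of_mem K ?_
    simp only [dyadicGrid, Finset.coe_image, Set.mem_image, Finset.coe_range, Set.mem_Iio]
    refine ⟨_, Nat.lt_succ_of_le (Nat.floor_le_of_le ?_), rfl⟩
    push_cast
    exact mul_le_of_le_one_left (by positivity) hx.2

lemma dyadicGrid_subset_Icc (K : ℕ) : (dyadicGrid K : Set ℝ) ⊆ Set.Icc 0 1 := by
  intro x hx
  simp only [dyadicGrid, Finset.coe_image, Set.mem_image, Finset.coe_range, Set.mem_Iio] at hx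
  obtain ⟨j, hj, rfl⟩ := hx
  refine ⟨by positivity, div_le_one_of_le₀ ?_ (by positivity)⟩
  exact_mod_cast Nat.le_of_lt_succ hj

lemma dyadicGrid_mono : Monotone dyadicGrid := by
  refine monotone_nat_of_le_succ fun K x hx ↦ ?_
  simp only [dyadicGrid, Finset.mem_image, Finset.mem_range] at hx ⊢
  obtain ⟨j, hj, rfl⟩ := hx
  refine ⟨2 * j, by rw [pow_succ]; omega, ?_⟩
  rw [pow_succ]
  push_cast
  field_simp

lemma IsDriftedFractionalField.exceedance_finset_le_card [IsProbabilityMeasure P]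
    (hZ : IsDriftedFractionalField κ c Z P) (hκ : 0 < κ) (F : Finset ℝ) :
    exceedance P Z F ≤ F.card := by
  refine (measure_biUnion_finset_le F _).trans ?_
  simp [hZ.prod_exceedanceSet hκ]

/-- A lowering of the levels by `2K` typical increments makes the error of the `K`-th chaining step,
a sum over about `2ᴷ⁺¹` points of terms of order `e⁻²ᴷ`, geometrically small. -/
lemma IsDriftedFractionalField.exceedance_dyadicGrid_succ_le
    (hZ : IsDriftedFractionalField κ c Z P) (hκ : 0 < κ) (K : ℕ) :
    exceedance P Z (dyadicGrid (K + 1)) ≤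
      ENNReal.ofReal (Real.exp (n * (2 * K * (2 ^ (-(κ / 2))) ^ (K + 1)))) *
        exceedance P Z (dyadicGrid K) +
      ENNReal.ofReal (4 * (∑ i, Real.exp (2 * c i ^ 2)) * (1 / 2) ^ K) := by
  -- The Markov parameter is the inverse of the typical size of an increment over `2⁻¹⁻ᴷ`.
  set θ : ℝ := (2 ^ (κ / 2)) ^ (K + 1) with hθdef
  have hθ : 1 ≤ θ := one_le_pow₀ (Real.one_le_rpow one_le_two (by positivity))
  have hinv : (2 ^ (-(κ / 2)) : ℝ) ^ (K + 1) = θ⁻¹ := by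
    rw [Real.rpow_neg zero_le_two, inv_pow]
  have hδ : ((1 / 2 : ℝ) ^ (K + 1)) ^ κ = (θ * θ)⁻¹ := by
    rw [hθdef, ← mul_pow, ← Real.rpow_add two_pos, add_halves, ← inv_pow,
      ← Real.rpow_neg zero_le_two, one_div, inv_pow, ← Real.rpow_natCast,
      ← Real.rpow_neg zero_le_two, ← Real.rpow_natCast, ← Real.rpow_mul zero_le_two,
      ← Real.rpow_mul zero_le_two]
    congr 1
    ring
  refine (hZ.exceedance_le_of_forall_exists hκ (dyadicGrid K).countable_toSet
    (fun t ht ↦ exists_mem_dyadicGrid ht) (2 * K * (2 ^ (-(κ / 2))) ^ (K + 1))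
    (zero_le_one.trans hθ)).trans ?_
  gcongr
  rw [hδ, hinv]
  have hterm : ∀ i, Real.exp (c i ^ 2 * (θ * (1 + θ) * (θ * θ)⁻¹) - θ * (2 * K * θ⁻¹))
      ≤ Real.exp (2 * c i ^ 2) * (1 / 4) ^ K := fun i ↦ by
    have h1 : θ * (1 + θ) * (θ * θ)⁻¹ ≤ 2 := by
      rw [← div_eq_mul_inv, div_le_iff₀ (by positivity)]
      nlinarith
    have h2 : θ * (2 * K * θ⁻¹) = 2 * K := by field_simp
    have h3 : Real.exp (-2) ≤ 1 / 4 := by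
      have : (2 : ℝ) ≤ Real.exp 1 := by linarith [Real.add_one_le_exp (1 : ℝ)]
      rw [Real.exp_neg, ← one_div, show (2 : ℝ) = 1 + 1 by norm_num, Real.exp_add]
      refine one_div_le_one_div_of_le (by norm_num) ?_
      nlinarith
    calc _ ≤ Real.exp (2 * c i ^ 2 + K * (-2)) := by
          rw [h2]
          gcongr
          nlinarith [mul_le_mul_of_nonneg_left h1 (sq_nonneg (c i))]
      _ = Real.exp (2 * c i ^ 2) * Real.exp (-2) ^ K := by
          rw [Real.exp_add, Real.exp_nat_mul]
      _ ≤ _ := by gcongr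
  have hcard : ((dyadicGrid (K + 1)).card : ℝ≥0∞) ≤ ENNReal.ofReal (2 ^ (K + 2)) := by
    rw [ENNReal.ofReal_pow zero_le_two, ENNReal.ofReal_ofNat]
    exact_mod_cast card_dyadicGrid_le (K + 1)
  calc _ ≤ ENNReal.ofReal (2 ^ (K + 2)) *
        ENNReal.ofReal (∑ i, Real.exp (2 * c i ^ 2) * (1 / 4) ^ K) := by
        gcongr with i
        exact hterm i
    _ = _ := by
        rw [← ENNReal.ofReal_mul (by positivity), ← Finset.sum_mul]
        congr 1
        rw [show (1 / 4 : ℝ) = (1 / 2) * (1 / 2) by norm_num, mul_pow, pow_add]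
        have : (2 : ℝ) ^ K * (1 / 2) ^ K = 1 := by rw [← mul_pow]; norm_num
        linear_combination (4 * (∑ i, Real.exp (2 * c i ^ 2)) * (1 / 2) ^ K) * this

lemma IsDriftedFractionalField.exists_exceedance_dyadicGrid_le [IsProbabilityMeasure P]
    (hZ : IsDriftedFractionalField κ c Z P) (hκ : 0 < κ) :
    ∃ b : ℝ, ∀ K, exceedance P Z (dyadicGrid K) ≤ ENNReal.ofReal b := by
  set r : ℝ := 2 ^ (-(κ / 2)) with hr
  have hr0 : 0 < r := by positivity
  have hr1 : r < 1 := Real.rpow_lt_one_of_one_lt_of_neg one_lt_two (by linarith)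
  set d : ℕ → ℝ := fun K ↦ 2 * K * r ^ (K + 1) with hd
  set A : ℝ := ∑ i, Real.exp (2 * c i ^ 2) with hA
  have hA0 : 0 ≤ A := Finset.sum_nonneg fun i _ ↦ (Real.exp_pos _).le
  have hd0 : ∀ K, 0 ≤ d K := fun K ↦ by positivity
  have hsum : Summable d := by
    have := (summable_pow_mul_geometric_of_norm_lt_one 1
      (by rwa [Real.norm_of_nonneg hr0.le] : ‖r‖ < 1)).mul_left (2 * r)
    refine this.congr fun K ↦ ?_
    simp only [hd]
    ring
  have hind : ∀ K, exceedance P Z (dyadicGrid K) ≤ ENNReal.ofReal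
      (Real.exp (n * ∑ j ∈ Finset.range K, d j) *
        (2 + 4 * A * ∑ j ∈ Finset.range K, (1 / 2 : ℝ) ^ j)) := by
    intro K
    induction K with
    | zero =>
      refine (hZ.exceedance_finset_le_card hκ _).trans ?_
      simpa using card_dyadicGrid_le 0
    | succ K ih =>
      refine (hZ.exceedance_dyadicGrid_succ_le hκ K).trans ?_
      refine (add_le_add_left (mul_le_mul_right ih _) _).trans ?_
      rw [← ENNReal.ofReal_mul (Real.exp_pos _).le, ← ENNReal.ofReal_add (by positivity)
        (by positivity)]
      refine ENNReal.ofReal_le_ofReal ?_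
      have hone : 1 ≤ Real.exp (n * ∑ j ∈ Finset.range (K + 1), d j) :=
        Real.one_le_exp (mul_nonneg n.cast_nonneg (Finset.sum_nonneg fun j _ ↦ hd0 j))
      have hsplit : Real.exp (n * ∑ j ∈ Finset.range (K + 1), d j)
          = Real.exp (n * d K) * Real.exp (n * ∑ j ∈ Finset.range K, d j) := by
        rw [← Real.exp_add, Finset.sum_range_succ]
        ring_nf
      have hnn : 0 ≤ 4 * A * (1 / 2 : ℝ) ^ K := by positivity
      have hle := mul_le_mul_of_nonneg_right hone hnn
      rw [Finset.sum_range_succ (fun j ↦ (1 / 2 : ℝ) ^ j)]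
      rw [hsplit] at hle ⊢
      change Real.exp (n * d K) * _ + 4 * A * (1 / 2) ^ K ≤ _
      linarith
  refine ⟨Real.exp (n * ∑' j, d j) * (2 + 4 * A * 2), fun K ↦ (hind K).trans ?_⟩
  refine ENNReal.ofReal_le_ofReal ?_
  have h1 := hsum.sum_le_tsum (Finset.range K) fun j _ ↦ hd0 j
  have h2 : ∑ j ∈ Finset.range K, (1 / 2 : ℝ) ^ j ≤ 2 := by
    exact (summable_geometric_two.sum_le_tsum _ fun j _ ↦ by positivity).trans_eq
      tsum_geometric_two
  gcongr

lemma pickandsIntegral_one_lt_top [IsProbabilityMeasure P] {B : Fin n → ℝ → Ω → ℝ} (hκ : 0 < κ)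
    (hB : IsVectorFractionalBrownianMotion (κ / 2) B P) : pickandsIntegral P c B 1 < ∞ := by
  have hm := hB.aemeasurable
  obtain ⟨b, hb⟩ := (hB.isDriftedFractionalField c hm).exists_exceedance_dyadicGrid_le hκ
  refine lt_of_le_of_lt ?_ (ENNReal.ofReal_lt_top (r := b))
  rw [pickandsIntegral_eq_exceedance hκ hB hm
    (Set.countable_iUnion fun K ↦ (dyadicGrid K).countable_toSet)
    (Set.iUnion_subset dyadicGrid_subset_Icc) subset_closure_iUnion_dyadicGrid, exceedance]
  have hmono : Monotone fun K ↦
      ⋃ t ∈ (dyadicGrid K : Set ℝ), exceedanceSet (driftedField P κ c B hm) t := fun K L hKL ↦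
    Set.biUnion_subset_biUnion_left (Finset.coe_subset.2 (dyadicGrid_mono hKL))
  rw [Set.biUnion_iUnion, hmono.measure_iUnion]
  exact iSup_le hb

end Chaining

/-! ### Existence of the limit -/

/-- Fekete's lemma for monotone subadditive functions of a real variable. -/
lemma exists_tendsto_inv_mul_of_subadditive {f : ℝ → ℝ≥0∞} (hf : Monotone f)
    (hadd : ∀ S T, 0 ≤ S → 0 ≤ T → f (S + T) ≤ f S + f T) (h1 : f 1 < ∞) :
    ∃ L : ℝ, Tendsto (fun S : ℝ ↦ ENNReal.ofReal S⁻¹ * f S) atTop (𝓝 (ENNReal.ofReal L)) := by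
  have hnat : ∀ m : ℕ, f m < ∞ := fun m ↦ by
    induction m with
    | zero => exact (hf (by simp)).trans_lt h1
    | succ m ih =>
      push_cast
      exact (hadd _ _ m.cast_nonneg zero_le_one).trans_lt (ENNReal.add_lt_top.2 ⟨ih, h1⟩)
  have hfin : ∀ S, f S ≠ ∞ := fun S ↦ ((hf (Nat.le_ceil S)).trans_lt (hnat _)).ne
  let u : ℕ → ℝ := fun m ↦ (f m).toReal
  have hu : Subadditive u := fun m k ↦ by
    simp only [u]
    rw [← ENNReal.toReal_add (hfin _) (hfin _)]
    refine ENNReal.toReal_mono (ENNReal.add_ne_top.2 ⟨hfin _, hfin _⟩) ?_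
    push_cast
    exact hadd _ _ m.cast_nonneg k.cast_nonneg
  have hbdd : BddBelow (Set.range fun m ↦ u m / m) := by
    refine ⟨0, ?_⟩
    rintro _ ⟨m, rfl⟩
    exact div_nonneg ENNReal.toReal_nonneg m.cast_nonneg
  have hlim := hu.tendsto_lim hbdd
  have hlow : Tendsto (fun S : ℝ ↦ u ⌊S⌋₊ / ⌊S⌋₊ * (⌊S⌋₊ / S)) atTop (𝓝 hu.lim) := by
    simpa using (hlim.comp tendsto_nat_floor_atTop).mul (tendsto_nat_floor_div_atTop (R := ℝ))
  have hupp : Tendsto (fun S : ℝ ↦ u ⌈S⌉₊ / ⌈S⌉₊ * (⌈S⌉₊ / S)) atTop (𝓝 hu.lim) := by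
    simpa using (hlim.comp tendsto_nat_ceil_atTop).mul (tendsto_nat_ceil_div_atTop (R := ℝ))
  have hreal : Tendsto (fun S : ℝ ↦ S⁻¹ * (f S).toReal) atTop (𝓝 hu.lim) := by
    refine tendsto_of_tendsto_of_tendsto_of_le_of_le' hlow hupp ?_ ?_
    · filter_upwards [eventually_ge_atTop 1] with S hS
      have hpos : (0 : ℝ) < ⌊S⌋₊ := by exact_mod_cast Nat.floor_pos.2 hS
      have hle : u ⌊S⌋₊ ≤ (f S).toReal :=
        ENNReal.toReal_mono (hfin _) (hf (Nat.floor_le (zero_le_one.trans hS)))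
      rw [div_mul_div_cancel₀ hpos.ne', div_eq_inv_mul]
      gcongr
    · filter_upwards [eventually_ge_atTop 1] with S hS
      have hpos : (0 : ℝ) < ⌈S⌉₊ := by exact_mod_cast Nat.ceil_pos.2 (zero_lt_one.trans_le hS)
      have hle : (f S).toReal ≤ u ⌈S⌉₊ := ENNReal.toReal_mono (hfin _) (hf (Nat.le_ceil S))
      rw [div_mul_div_cancel₀ hpos.ne', div_eq_inv_mul]
      gcongr
  refine ⟨hu.lim, ((ENNReal.continuous_ofReal.tendsto _).comp hreal).congr' ?_⟩
  filter_upwards [eventually_ge_atTop 0] with S hS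
  rw [Function.comp_apply, ENNReal.ofReal_mul (inv_nonneg.2 hS), ENNReal.ofReal_toReal (hfin S)]

section Limit

variable {Ω : Type*} [MeasurableSpace Ω] {P : Measure Ω} {n : ℕ} {κ : ℝ} {c : Fin n → ℝ}
  {B : Fin n → ℝ → Ω → ℝ}

lemma pickandsIntegral_mono : Monotone (pickandsIntegral P c B) := by
  intro S T hST
  refine lintegral_mono fun w ↦ ?_
  gcongr

/-- Union bound over `[0, S]` and `[S, S + T]`, together with stationarity. -/
lemma pickandsIntegral_add_le [IsProbabilityMeasure P] (hκ : 0 < κ)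
    (hB : IsVectorFractionalBrownianMotion (κ / 2) B P) (S T : ℝ) :
    pickandsIntegral P c B (S + T) ≤ pickandsIntegral P c B S + pickandsIntegral P c B T := by
  classical
  have hm := hB.aemeasurable
  have hZ := hB.isDriftedFractionalField c hm
  refine pickandsIntegral_le_of_forall_finset hκ hB hm fun F hF ↦ ?_
  have hsplit : (F : Set ℝ) = ((F.filter (· ≤ S) : Finset ℝ) : Set ℝ) ∪
      (fun t ↦ t + S) '' (((F.filter (¬ · ≤ S)).image (· - S) : Finset ℝ) : Set ℝ) := by
    ext t
    simp only [Finset.coe_filter, Finset.coe_image, Set.image_image, sub_add_cancel, Set.image_id',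
      Set.mem_union, Set.mem_ofPred_eq, Finset.mem_coe]
    tauto
  rw [hsplit]
  refine (exceedance_union_le _ _).trans ?_
  rw [hZ.exceedance_image_add_right]
  gcongr
  · refine exceedance_le_pickandsIntegral hκ hB hm fun t ht ↦ ?_
    simp only [Finset.coe_filter, Set.mem_ofPred_eq] at ht
    exact ⟨(hF ht.1).1, ht.2⟩
  · refine exceedance_le_pickandsIntegral hκ hB hm fun t ht ↦ ?_
    simp only [Finset.coe_image, Finset.coe_filter, Set.mem_image, Set.mem_ofPred_eq] at ht
    obtain ⟨s, ⟨hs, hs'⟩, rfl⟩ := ht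
    have := (hF hs).2
    exact ⟨by linarith, by linarith⟩

end Limit

/-! ### The lower bound by the second moment method -/

/-- A union of sets of measure one which overlap little has large measure. Integrate
`2 N ≤ q 𝟙(N > 0) + N² / q`, where `N` counts the sets containing a point. -/
lemma MeasureTheory.le_measure_biUnion_of_sum_inter_le {α ι : Type*} [MeasurableSpace α]
    {μ : Measure α} {A : ι → Set α} {s : Finset ι} (hA : ∀ j ∈ s, MeasurableSet (A j))
    (h1 : ∀ j ∈ s, μ (A j) = 1) {q : ℝ} (hq : 0 < q)
    (h2 : ∀ j ∈ s, ∑ k ∈ s, μ (A j ∩ A k) ≤ ENNReal.ofReal q) :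
    ENNReal.ofReal (s.card / q) ≤ μ (⋃ j ∈ s, A j) := by
  classical
  have hU : MeasurableSet (⋃ j ∈ s, A j) := s.measurableSet_biUnion hA
  have hpt : ∀ x, ENNReal.ofReal (2 / q) * ∑ j ∈ s, (A j).indicator 1 x
      ≤ (⋃ j ∈ s, A j).indicator 1 x +
        ENNReal.ofReal (1 / q ^ 2) * ∑ j ∈ s, ∑ k ∈ s, (A j ∩ A k).indicator 1 x := fun x ↦ by
    set m : ℕ := (s.filter (x ∈ A ·)).card with hm
    have hs1 : ∑ j ∈ s, (A j).indicator (1 : α → ℝ≥0∞) x = ENNReal.ofReal m := by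
      simp [Set.indicator_apply, hm]
    have hs2 : ∑ j ∈ s, ∑ k ∈ s, (A j ∩ A k).indicator (1 : α → ℝ≥0∞) x
        = ENNReal.ofReal (m * m) := by
      rw [ENNReal.ofReal_mul m.cast_nonneg, ← hs1, Finset.sum_mul_sum]
      simp_rw [Set.inter_indicator_one, Pi.mul_apply]
    rw [hs1, hs2, ← ENNReal.ofReal_mul (by positivity), ← ENNReal.ofReal_mul (by positivity)]
    by_cases hx : x ∈ ⋃ j ∈ s, A j
    · rw [Set.indicator_of_mem hx, Pi.one_apply, ← ENNReal.ofReal_one,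
        ← ENNReal.ofReal_add zero_le_one (by positivity)]
      refine ENNReal.ofReal_le_ofReal ?_
      have := sq_nonneg (1 - m / q)
      have e1 : 2 / q * m = 2 * (m / q) := by ring
      have e2 : 1 / q ^ 2 * (m * m) = (m / q) ^ 2 := by ring
      rw [e1, e2]
      linarith
    · have h0 : m = 0 := by
        rw [hm, Finset.card_eq_zero, Finset.filter_eq_empty_iff]
        intro j hj hxj
        exact hx (Set.mem_biUnion hj hxj)
      simp [h0]
  have hint := lintegral_mono (μ := μ) hpt
  rw [lintegral_const_mul' _ _ ENNReal.ofReal_ne_top,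
    lintegral_finsetSum' _ fun j hj ↦ (measurable_one.indicator (hA j hj)).aemeasurable,
    lintegral_add_left (measurable_one.indicator hU), lintegral_indicator_one hU,
    lintegral_const_mul' _ _ ENNReal.ofReal_ne_top,
    lintegral_finsetSum' _ fun j hj ↦ Finset.aemeasurable_fun_sum _ fun k hk ↦
      (measurable_one.indicator ((hA j hj).inter (hA k hk))).aemeasurable] at hint
  have e1 : ∑ j ∈ s, ∫⁻ x, (A j).indicator 1 x ∂μ = ENNReal.ofReal s.card := by
    rw [Finset.sum_congr rfl fun j hj ↦ (lintegral_indicator_one (hA j hj)).trans (h1 j hj)]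
    simp
  have e2 : ∑ j ∈ s, ∫⁻ x, ∑ k ∈ s, (A j ∩ A k).indicator 1 x ∂μ
      ≤ ENNReal.ofReal (s.card * q) := by
    rw [ENNReal.ofReal_mul (Nat.cast_nonneg _), ENNReal.ofReal_natCast, ← nsmul_eq_mul]
    refine Finset.sum_le_card_nsmul _ _ _ fun j hj ↦ le_trans (le_of_eq ?_) (h2 j hj)
    rw [lintegral_finsetSum' _ fun k hk ↦
      (measurable_one.indicator ((hA j hj).inter (hA k hk))).aemeasurable]
    exact Finset.sum_congr rfl fun k hk ↦ lintegral_indicator_one ((hA j hj).inter (hA k hk))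
  rw [e1, ← ENNReal.ofReal_mul (by positivity)] at hint
  have hmain := hint.trans (add_le_add_right (mul_le_mul_right e2 _) _)
  rw [← ENNReal.ofReal_mul (by positivity)] at hmain
  have e3 : 1 / q ^ 2 * (s.card * q) = s.card / q := by field_simp
  have e4 : 2 / q * s.card = s.card / q + s.card / q := by ring
  rw [e3, e4, ENNReal.ofReal_add (by positivity) (by positivity)] at hmain
  exact (ENNReal.add_le_add_iff_right ENNReal.ofReal_ne_top).1 hmain

lemma Finset.sum_range_abs_sub_le {g : ℝ → ℝ} (hg : ∀ x, 0 ≤ g x) {j N : ℕ} (hj : j < N) :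
    ∑ k ∈ range N, g |(j : ℝ) - k| ≤ g 0 + 2 * ∑ m ∈ range N, g ((m + 1 : ℕ) : ℝ) := by
  have hleft : ∑ k ∈ range j, g |(j : ℝ) - k| = ∑ m ∈ range j, g ((m + 1 : ℕ) : ℝ) := by
    rw [← sum_range_reflect]
    refine sum_congr rfl fun m hm ↦ ?_
    have hm' := mem_range.1 hm
    congr 1
    rw [Nat.sub_sub, Nat.cast_sub (by omega), abs_of_nonneg] <;> push_cast <;> ring_nf
    positivity
  have hright : ∑ k ∈ Ico (j + 1) N, g |(j : ℝ) - k|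
      = ∑ m ∈ range (N - (j + 1)), g ((m + 1 : ℕ) : ℝ) := by
    rw [sum_Ico_eq_sum_range]
    refine sum_congr rfl fun m _ ↦ ?_
    congr 1
    rw [abs_sub_comm, abs_of_nonneg] <;> push_cast <;> ring_nf
    positivity
  have hle1 : ∑ m ∈ range j, g ((m + 1 : ℕ) : ℝ) ≤ ∑ m ∈ range N, g ((m + 1 : ℕ) : ℝ) :=
    sum_le_sum_of_subset_of_nonneg (range_mono hj.le) fun _ _ _ ↦ hg _
  have hle2 : ∑ m ∈ range (N - (j + 1)), g ((m + 1 : ℕ) : ℝ)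
      ≤ ∑ m ∈ range N, g ((m + 1 : ℕ) : ℝ) :=
    sum_le_sum_of_subset_of_nonneg (range_mono (Nat.sub_le _ _)) fun _ _ _ ↦ hg _
  rw [← sum_range_add_sum_Ico _ (Nat.succ_le_of_lt hj), sum_range_succ, hleft, hright, sub_self,
    abs_zero]
  linarith

lemma sum_exp_neg_mul_rpow_le {b κ δ : ℝ} (hb : 0 < b) (hκ : 0 < κ) (hδ : 0 < δ) (N : ℕ) :
    ∑ m ∈ Finset.range N, Real.exp (-(b * (((m + 1 : ℕ) : ℝ) * δ) ^ κ))
      ≤ b ^ (-1 / κ) * Real.Gamma (1 / κ + 1) / δ := by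
  have hb' : 0 < b * δ ^ κ := by positivity
  have hint : ∫ x in Set.Ioi (0 : ℝ), Real.exp (-(b * δ ^ κ) * x ^ κ)
      = b ^ (-1 / κ) * Real.Gamma (1 / κ + 1) / δ := by
    rw [integral_exp_neg_mul_rpow hκ hb', Real.mul_rpow hb.le (by positivity),
      ← Real.rpow_mul hδ.le, mul_div_cancel₀ _ hκ.ne', Real.rpow_neg_one]
    ring
  have hpos : 0 < b ^ (-1 / κ) * Real.Gamma (1 / κ + 1) / δ := by
    have : 0 < Real.Gamma (1 / κ + 1) := Real.Gamma_pos_of_pos (by positivity)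
    positivity
  have hanti : AntitoneOn (fun x : ℝ ↦ Real.exp (-(b * δ ^ κ) * x ^ κ)) (Set.Icc 0 (N : ℝ)) := by
    intro x hx y hy hxy
    have := Real.rpow_le_rpow hx.1 hxy hκ.le
    simp only [Real.exp_le_exp]
    nlinarith
  have h := hanti.sum_range_le_integral
    (Integrable.of_integral_ne_zero (by rw [hint]; exact hpos.ne'))
    fun _ _ ↦ (Real.exp_pos _).le
  rw [hint] at h
  refine le_of_eq_of_le (Finset.sum_congr rfl fun m _ ↦ ?_) h
  rw [Real.mul_rpow (by positivity) hδ.le]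
  congr 1
  ring

section LowerBound

variable {Ω : Type*} [MeasurableSpace Ω] {P : Measure Ω} [IsProbabilityMeasure P] {n : ℕ} {κ : ℝ}
  {c : Fin n → ℝ} {B : Fin n → ℝ → Ω → ℝ}

/-- The second moment method on a grid of mesh `δ`, for the value of `δ` at which the exceedance
at a fixed time overlaps the other ones by at most `1` in total. -/
lemma le_pickandsIntegral_natCast_mul (hκ : 0 < κ)
    (hB : IsVectorFractionalBrownianMotion (κ / 2) B P) (hc : 0 < ∑ i, c i ^ 2) {δ : ℝ}
    (hδ : δ = 2 * (((∑ i, c i ^ 2) / 4) ^ (-1 / κ) * Real.Gamma (1 / κ + 1))) (N : ℕ) :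
    ENNReal.ofReal (N / 2) ≤ pickandsIntegral P c B (N * δ) := by
  have hm := hB.aemeasurable
  have hZ := hB.isDriftedFractionalField c hm
  set b : ℝ := (∑ i, c i ^ 2) / 4 with hb
  have hb0 : 0 < b := by positivity
  have hδ0 : 0 < δ := by
    have : 0 < Real.Gamma (1 / κ + 1) := Real.Gamma_pos_of_pos (by positivity)
    rw [hδ]; positivity
  have hoverlap : ∀ j ∈ Finset.range N, ∑ k ∈ Finset.range N, (P.prod (expWeight n))
      (exceedanceSet (driftedField P κ c B hm) (j * δ) ∩
        exceedanceSet (driftedField P κ c B hm) (k * δ)) ≤ ENNReal.ofReal 2 := fun j hj ↦ by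
    refine (Finset.sum_le_sum fun (k : ℕ) _ ↦
      hZ.prod_exceedanceSet_inter_le hκ (j * δ) (k * δ)).trans ?_
    rw [← ENNReal.ofReal_sum_of_nonneg fun k _ ↦ (Real.exp_pos _).le]
    refine ENNReal.ofReal_le_ofReal ?_
    have h := Finset.sum_range_abs_sub_le (g := fun x ↦ Real.exp (-(b * (x * δ) ^ κ)))
      (fun _ ↦ (Real.exp_pos _).le) (Finset.mem_range.1 hj)
    have h' := sum_exp_neg_mul_rpow_le hb0 hκ hδ0 N
    have hhalf : b ^ (-1 / κ) * Real.Gamma (1 / κ + 1) / δ = 1 / 2 := by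
      rw [div_eq_div_iff hδ0.ne' two_ne_zero, hδ]; ring
    have hone : Real.exp (-(b * (0 * δ) ^ κ)) = 1 := by simp [Real.zero_rpow hκ.ne']
    have habs : ∀ k : ℕ, |(j : ℝ) * δ - k * δ| = |(j : ℝ) - k| * δ := fun k ↦ by
      rw [← sub_mul, abs_mul, abs_of_pos hδ0]
    simp only [habs]
    rw [hhalf] at h'
    simp only [hone] at h
    linarith
  have hsm := le_measure_biUnion_of_sum_inter_le (s := Finset.range N)
    (fun j _ ↦ hZ.measurableSet_exceedanceSet (j * δ)) (fun j _ ↦ hZ.prod_exceedanceSet hκ (j * δ))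
    two_pos hoverlap
  rw [Finset.card_range] at hsm
  refine hsm.trans (le_trans (le_of_eq ?_) (exceedance_le_pickandsIntegral hκ hB hm
    (F := (Finset.range N).image fun k : ℕ ↦ (k : ℝ) * δ) fun t ht ↦ ?_))
  · rw [exceedance]
    simp
  · simp only [Finset.coe_image, Finset.coe_range, Set.mem_image, Set.mem_Iio] at ht
    obtain ⟨k, hk, rfl⟩ := ht
    have : (k : ℝ) ≤ N := by exact_mod_cast hk.le
    exact ⟨by positivity, by gcongr⟩

end LowerBound

theorem proposition3p2 {Ω : Type*} [MeasurableSpace Ω] (P : Measure Ω) [IsProbabilityMeasure P]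
    (n : ℕ) (κ : ℝ) (hκ : κ ∈ Set.Ioc (0 : ℝ) 2)
    (C : Fin n → ℝ) (hC : 0 ≤ C) (hC0 : C ≠ 0)
    (B : Fin n → ℝ → Ω → ℝ) (hB : IsVectorFractionalBrownianMotion (κ / 2) B P) :
    Tendsto (fun S : ℝ ↦ ENNReal.ofReal S⁻¹ * pickandsIntegral P C B S) atTop
        (𝓝 (pickandsConstant P C B)) ∧
      pickandsConstant P C B < ∞ ∧
      ENNReal.ofReal ((∑ i, C i ^ 2) ^ (1 / κ) /
          ((4 : ℝ) ^ (1 + 1 / κ) * Real.Gamma (1 / κ + 1))) ≤ pickandsConstant P C B ∧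
      0 < pickandsConstant P C B := by
  have hκ0 := hκ.1
  obtain ⟨i₀, hi₀⟩ := Function.ne_iff.1 hC0
  have hσ : 0 < ∑ i, C i ^ 2 :=
    Finset.sum_pos' (fun i _ ↦ sq_nonneg _) ⟨i₀, Finset.mem_univ _, pow_pos
      (lt_of_le_of_ne (hC i₀) (Ne.symm hi₀)) 2⟩
  obtain ⟨L, hL⟩ := exists_tendsto_inv_mul_of_subadditive (f := pickandsIntegral P C B)
    pickandsIntegral_mono (fun S T _ _ ↦ pickandsIntegral_add_le hκ0 hB S T)
    (pickandsIntegral_one_lt_top hκ0 hB)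
  have hlim : pickandsConstant P C B = ENNReal.ofReal L := hL.limUnder_eq
  have hΓ : 0 < Real.Gamma (1 / κ + 1) := Real.Gamma_pos_of_pos (by positivity)
  -- `δ / 2` is the integral of `exp (-(∑ᵢ Cᵢ² / 4) u ^ κ)` over `u > 0`.
  set δ : ℝ := 2 * (((∑ i, C i ^ 2) / 4) ^ (-1 / κ) * Real.Gamma (1 / κ + 1)) with hδ
  have hδ0 : 0 < δ := by positivity
  have hconst : (∑ i, C i ^ 2) ^ (1 / κ) / ((4 : ℝ) ^ (1 + 1 / κ) * Real.Gamma (1 / κ + 1))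
      = (2 * δ)⁻¹ := by
    rw [hδ, Real.rpow_add (by norm_num), Real.rpow_one, neg_div, Real.rpow_neg (by positivity),
      Real.div_rpow hσ.le (by norm_num)]
    field_simp
    norm_num
  have hbound : ENNReal.ofReal ((∑ i, C i ^ 2) ^ (1 / κ) /
      ((4 : ℝ) ^ (1 + 1 / κ) * Real.Gamma (1 / κ + 1))) ≤ ENNReal.ofReal L := by
    have hseq : Tendsto (fun N : ℕ ↦ (N : ℝ) * δ) atTop atTop :=
      tendsto_natCast_atTop_atTop.atTop_mul_const hδ0
    refine ge_of_tendsto (hL.comp hseq) ?_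
    filter_upwards [eventually_gt_atTop 0] with N hN
    have hN' : (0 : ℝ) < N := by exact_mod_cast hN
    have h := le_pickandsIntegral_natCast_mul hκ0 hB hσ hδ N
    calc _ = ENNReal.ofReal (N * δ)⁻¹ * ENNReal.ofReal (N / 2) := by
          rw [hconst, ← ENNReal.ofReal_mul (by positivity)]
          congr 1
          field_simp
      _ ≤ _ := mul_le_mul_right h _
  rw [hlim]
  refine ⟨hL, ENNReal.ofReal_lt_top, hbound, lt_of_lt_of_le ?_ hbound⟩
  exact ENNReal.ofReal_pos.2 (by positivity)
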